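/- Let $k \ge 0$, let $G_1,\dots,G_k$ be finite cyclic groups of orders $n_1,\dots,n_k \ge 1$, and let $G=G_1\times\cdots\times G_k$. Let $A$ be any abelian group (written additively), regarded as a $G$-module with the trivial action. Then there is an isomorphism of abelian groups $$H^2(G,A)\;\cong\;\Bigl(\bigoplus_{i=1}^{k} A/n_iA\Bigr)\;\oplus\;\Bigl(\bigoplus_{1\le i<j\le k}\mathrm{Ann}_A(n_i)\cap\mathrm{Ann}_A(n_j)\Bigr),$$ where $H^2(G,A)=\mathrm{Ext}^2_{\mathbb{Z}[G]}(\mathbb{Z},A)$ denotes group cohomology, $n_iA=\{n_i a : a\in A\}$ and $\mathrm{Ann}_A(m)=\{a\in A : m a=0\}$. -/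

import Mathlib

open scoped DirectSum

universe u v

/-- The cohomology `Hⁿ(G, A)` of a group `G` with coefficients in an abelian group `A` on which
`G` acts trivially. Mathlib's `groupCohomology` wants the coefficient ring, the group and the
module in a single universe, so `ℤ`, `G` and `A` are lifted to the larger one. -/
noncomputable abbrev trivialCohomology (G : Type u) [Group G] (A : Type v) [AddCommGroup A]
    (n : ℕ) : ModuleCat.{max u v} (ULift.{max u v} ℤ) :=
  groupCohomology
    (Rep.trivial (ULift.{max u v} ℤ) (ULift.{v} G) (ULift.{u} A)) n

/-- The subgroup `mA = {m a : a ∈ A}` of an abelian group `A`. -/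
def multiples (A : Type v) [AddCommGroup A] (m : ℕ) : AddSubgroup A :=
  (nsmulAddMonoidHom (α := A) m).range

/-- The subgroup `Ann_A(m) = {a ∈ A : m a = 0}` of an abelian group `A`. -/
def annihilatedBy (A : Type v) [AddCommGroup A] (m : ℕ) : AddSubgroup A :=
  (nsmulAddMonoidHom (α := A) m).ker

/-! For trivial coefficients, a class in H²(G × H, A) is the same as its restrictions to G and H
together with the commutator pairing f(g, h) − f(h, g), an arbitrary biadditive map G × H → A
(`TrivialH2.nonempty_prod_addEquiv`). One cyclic factor is peeled off at a time. It contributes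
A/nA, by the periodic resolution (`trivialCohomology_two_addEquiv_of_isCyclic`), and its pairings
with the other factors, each fixed by the value on generators, which can be any element killed by
both orders (`biadditive.nonempty_addEquiv_pi`). -/

/-- A surjection with the same kernel as another one has an isomorphic target. -/
theorem nonempty_addEquiv_of_ker_eq {X Y Z : Type*} [AddCommGroup X] [AddCommGroup Y]
    [AddCommGroup Z] (f : X →+ Y) (g : X →+ Z) (hf : Function.Surjective f)
    (hg : Function.Surjective g) (h : ∀ x, f x = 0 ↔ g x = 0) : Nonempty (Y ≃+ Z) :=
  ⟨(QuotientAddGroup.quotientKerEquivOfSurjective f hf).symm.trans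
    ((QuotientAddGroup.quotientAddEquivOfEq (by ext x; exact h x)).trans
      (QuotientAddGroup.quotientKerEquivOfSurjective g hg))⟩

/-! ### Künneth decomposition of H² by explicit cocycles. -/

section Cocycles

variable (G : Type*) [Group G] (A : Type*) [AddCommGroup A]

/-- Inhomogeneous 2-cocycles of `G` with values in the trivial module `A`. -/
def twoCocycles : AddSubgroup (G → G → A) where
  carrier := {f | ∀ g h j, f (g * h) j + f g h = f h j + f g (h * j)}
  zero_mem' := by simp
  add_mem' := by
    intro a b ha hb g h j
    have := congrArg₂ (· + ·) (ha g h j) (hb g h j)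
    simp only [Pi.add_apply] at this ⊢
    convert this using 1 <;> abel
  neg_mem' := by
    intro a ha g h j
    have := congrArg Neg.neg (ha g h j)
    simp only [Pi.neg_apply] at this ⊢
    convert this using 1 <;> abel

/-- The 2-coboundaries among the 2-cocycles. -/
def twoCoboundaries : AddSubgroup (twoCocycles G A) where
  carrier := {f | ∃ x : G → A, ∀ g h, f.1 g h = x h - x (g * h) + x g}
  zero_mem' := ⟨0, by simp⟩
  add_mem' := by
    rintro a b ⟨x, hx⟩ ⟨y, hy⟩
    refine ⟨x + y, fun g h => ?_⟩
    simp only [AddSubgroup.coe_add, Pi.add_apply, hx, hy]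
    abel
  neg_mem' := by
    rintro a ⟨x, hx⟩
    refine ⟨-x, fun g h => ?_⟩
    simp only [AddSubgroup.coe_neg, Pi.neg_apply, hx]
    abel

/-- 2-cocycles of `G` with values in the trivial module `A`, modulo 2-coboundaries. -/
abbrev TrivialH2 : Type _ := twoCocycles G A ⧸ twoCoboundaries G A

/-- Maps `G × H → A` that are multiplicative in each variable. -/
def biadditive (H : Type*) [Group H] : AddSubgroup (G → H → A) where
  carrier := {b | (∀ g g' h, b (g * g') h = b g h + b g' h) ∧
    ∀ g h h', b g (h * h') = b g h + b g h'}
  zero_mem' := by simp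
  add_mem' := by
    rintro a b ⟨ha, ha'⟩ ⟨hb, hb'⟩
    refine ⟨fun g g' h => ?_, fun g h h' => ?_⟩
    · simp only [Pi.add_apply, ha, hb]; abel
    · simp only [Pi.add_apply, ha', hb']; abel
  neg_mem' := by
    rintro a ⟨ha, ha'⟩
    refine ⟨fun g g' h => ?_, fun g h h' => ?_⟩
    · simp only [Pi.neg_apply, ha]; abel
    · simp only [Pi.neg_apply, ha']; abel

variable {G A}

theorem twoCocycles_one_left (f : twoCocycles G A) (g : G) : f.1 1 g = f.1 1 1 := by
  simpa using (f.2 1 1 g).symm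

theorem twoCocycles_one_right (f : twoCocycles G A) (g : G) : f.1 g 1 = f.1 1 1 := by
  simpa using f.2 g 1 1

theorem TrivialH2.mk_eq_zero_iff (f : twoCocycles G A) :
    (QuotientAddGroup.mk f : TrivialH2 G A) = 0 ↔
      ∃ x : G → A, ∀ g h, f.1 g h = x h - x (g * h) + x g :=
  QuotientAddGroup.eq_zero_iff f

/-- A constant cocycle c is the coboundary of the constant function c. This absorbs the values f(1,
1), since cocycles are not assumed normalized. -/
theorem TrivialH2.mk_eq_mk_of_sub {f f' : twoCocycles G A} (c : A)
    (h : ∀ x y, f'.1 x y = f.1 x y + c) :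
    (QuotientAddGroup.mk f' : TrivialH2 G A) = QuotientAddGroup.mk f := by
  rw [← sub_eq_zero, ← QuotientAddGroup.mk_sub, TrivialH2.mk_eq_zero_iff]
  exact ⟨fun _ => c, fun x y => by simp [h]⟩

/-- The commutator pairing of a 2-cocycle is multiplicative on commuting elements. -/
theorem twoCocycles_commutator_mul (f : twoCocycles G A) {x x' y : G} (h : x * y = y * x)
    (h' : x' * y = y * x') :
    f.1 (x * x') y - f.1 y (x * x') =
      (f.1 x y - f.1 y x) + (f.1 x' y - f.1 y x') := by
  have h1 := f.2 x x' y
  have h2 := f.2 y x x'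
  have h3 := f.2 x y x'
  rw [h'] at h1
  rw [← h] at h2
  grind

/-- Pull-back of 2-cocycles. -/
def twoCocycles.comap {H : Type*} [Group H] (φ : H →* G) : twoCocycles G A →+ twoCocycles H A where
  toFun f := ⟨fun x y => f.1 (φ x) (φ y), fun g h j => by simpa using f.2 (φ g) (φ h) (φ j)⟩
  map_zero' := rfl
  map_add' _ _ := rfl

/-- The commutator pairing between the two factors of a product. -/
def twoCocycles.pairing {H : Type*} [Group H] : twoCocycles (G × H) A →+ biadditive G A H where
  toFun f := ⟨fun g h => f.1 (g, 1) (1, h) - f.1 (1, h) (g, 1), by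
    refine ⟨fun g g' h => ?_, fun g h h' => ?_⟩
    · simpa using twoCocycles_commutator_mul f (x := (g, 1)) (x' := (g', 1)) (y := (1, h))
        (by simp) (by simp)
    · have := twoCocycles_commutator_mul f (x := (1, h)) (x' := (1, h')) (y := (g, 1))
        (by simp) (by simp)
      simp only [Prod.mk_mul_mk, mul_one] at this
      grind⟩
  map_zero' := by ext; simp
  map_add' a b := by
    ext g h
    simp only [AddSubgroup.coe_add, Pi.add_apply]
    abel

/-- Restriction to the factors and the commutator pairing. -/
def twoCocycles.decompose {H : Type*} [Group H] :
    twoCocycles (G × H) A →+ TrivialH2 G A × TrivialH2 H A × biadditive G A H :=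
  ((QuotientAddGroup.mk' _).comp (comap (MonoidHom.inl G H))).prod
    (((QuotientAddGroup.mk' _).comp (comap (MonoidHom.inr G H))).prod pairing)

theorem twoCocycles.decompose_surjective {H : Type*} [Group H] :
    Function.Surjective (decompose : twoCocycles (G × H) A →+ _) := by
  rintro ⟨a, b, χ⟩
  obtain ⟨f₁, rfl⟩ := QuotientAddGroup.mk_surjective a
  obtain ⟨f₂, rfl⟩ := QuotientAddGroup.mk_surjective b
  have hl : ∀ h, χ.1 1 h = 0 := fun h => by simpa using χ.2.1 1 1 h
  have hr : ∀ g, χ.1 g 1 = 0 := fun g => by simpa using χ.2.2 g 1 1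
  refine ⟨⟨fun x y => f₁.1 x.1 y.1 + f₂.1 x.2 y.2 + χ.1 x.1 y.2, ?_⟩, ?_⟩
  · intro x y z
    have h1 := f₁.2 x.1 y.1 z.1
    have h2 := f₂.2 x.2 y.2 z.2
    simp only [Prod.fst_mul, Prod.snd_mul, χ.2.1, χ.2.2]
    grind
  · refine Prod.ext ?_ (Prod.ext ?_ ?_)
    · exact TrivialH2.mk_eq_mk_of_sub (f₂.1 1 1) fun x y => by
        simp [twoCocycles.comap, hr]
    · exact TrivialH2.mk_eq_mk_of_sub (f₁.1 1 1) fun x y => by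
        simp [twoCocycles.comap, hl, add_comm]
    · ext g h
      simp [decompose, pairing, twoCocycles_one_left f₁ g, twoCocycles_one_right f₁ g,
        twoCocycles_one_left f₂ h, twoCocycles_one_right f₂ h, hl]

/-- In the central extension given by f, a zero pairing says that lifts of the two factors commute,
so splittings over G and over H combine into one over G × H. -/
theorem twoCocycles.decompose_eq_zero_iff {H : Type*} [Group H] (f : twoCocycles (G × H) A) :
    decompose f = 0 ↔ (QuotientAddGroup.mk f : TrivialH2 (G × H) A) = 0 := by
  have key : decompose f = 0 ↔
      (QuotientAddGroup.mk (comap (MonoidHom.inl G H) f) : TrivialH2 G A) = 0 ∧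
      (QuotientAddGroup.mk (comap (MonoidHom.inr G H) f) : TrivialH2 H A) = 0 ∧
      pairing f = 0 := by
    simp [decompose, Prod.ext_iff]
  rw [key]
  simp only [TrivialH2.mk_eq_zero_iff]
  constructor
  · rintro ⟨⟨α, hα⟩, ⟨β, hβ⟩, hχ⟩
    -- Forced by the coboundary equation at the pair ((g, 1), (1, h)).
    refine ⟨fun p => α p.1 + β p.2 - f.1 (p.1, 1) (1, p.2), ?_⟩
    rintro ⟨g, h⟩ ⟨g', h'⟩
    have hα := hα g g'
    have hβ := hβ h h'
    have hχ : f.1 (g', 1) (1, h) - f.1 (1, h) (g', 1) = 0 :=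
      congrFun (congrFun (congrArg Subtype.val hχ) g') h
    have h1 := f.2 (g, 1) (1, h) (g', h')
    have h2 := f.2 (1, h) (g', 1) (1, h')
    have h3 := f.2 (g', 1) (1, h) (1, h')
    have h4 := f.2 (g, 1) (g', 1) (1, h * h')
    simp only [comap, AddMonoidHom.coe_mk, ZeroHom.coe_mk, MonoidHom.inl_apply,
      MonoidHom.inr_apply, Prod.mk_mul_mk, one_mul, mul_one] at *
    grind
  · rintro ⟨x, hx⟩
    refine ⟨⟨fun g => x (g, 1), fun g h => ?_⟩, ⟨fun g => x (1, g), fun g h => ?_⟩, ?_⟩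
    · simp [comap, hx]
    · simp [comap, hx]
    · ext g h
      simp only [pairing, AddMonoidHom.coe_mk, ZeroHom.coe_mk, hx, Prod.mk_mul_mk, one_mul, mul_one,
        AddSubgroup.coe_zero, Pi.zero_apply]
      abel

theorem TrivialH2.nonempty_prod_addEquiv (G H A : Type*) [Group G] [Group H] [AddCommGroup A] :
    Nonempty (TrivialH2 (G × H) A ≃+ TrivialH2 G A × TrivialH2 H A × biadditive G A H) :=
  nonempty_addEquiv_of_ker_eq (QuotientAddGroup.mk' _) twoCocycles.decompose
    (QuotientAddGroup.mk'_surjective _) twoCocycles.decompose_surjective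
    fun f => (twoCocycles.decompose_eq_zero_iff f).symm

theorem TrivialH2.nonempty_congr {G H : Type*} [Group G] [Group H] (e : G ≃* H) (A : Type*)
    [AddCommGroup A] : Nonempty (TrivialH2 G A ≃+ TrivialH2 H A) := by
  refine nonempty_addEquiv_of_ker_eq (QuotientAddGroup.mk' _)
    ((QuotientAddGroup.mk' _).comp (twoCocycles.comap e.symm.toMonoidHom))
    (QuotientAddGroup.mk'_surjective _)
    ((QuotientAddGroup.mk'_surjective _).comp fun f =>
      ⟨twoCocycles.comap e.toMonoidHom f, ?_⟩) fun f => ?_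
  · ext x y
    simp [twoCocycles.comap]
  · simp only [AddMonoidHom.comp_apply, QuotientAddGroup.mk'_apply, TrivialH2.mk_eq_zero_iff]
    constructor
    · rintro ⟨x, hx⟩
      exact ⟨x ∘ e.symm, fun g h => by simp [twoCocycles.comap, hx]⟩
    · rintro ⟨x, hx⟩
      refine ⟨x ∘ e, fun g h => ?_⟩
      simpa [twoCocycles.comap] using hx (e g) (e h)

theorem TrivialH2.subsingleton (G A : Type*) [Group G] [Subsingleton G] [AddCommGroup A] :
    Subsingleton (TrivialH2 G A) := by
  refine subsingleton_of_forall_eq 0 fun a => ?_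
  obtain ⟨f, rfl⟩ := QuotientAddGroup.mk_surjective a
  refine (TrivialH2.mk_eq_zero_iff f).2 ⟨fun _ => f.1 1 1, fun g h => ?_⟩
  simp [Subsingleton.elim g 1, Subsingleton.elim h 1]

end Cocycles

/-! ### Comparison with `groupCohomology`, and the cyclic case. -/

/-- The comparison of `trivialCohomology` with cocycles modulo coboundaries. -/
theorem trivialCohomology_two_addEquiv (G : Type u) [Group G] (A : Type v) [AddCommGroup A] :
    Nonempty (TrivialH2 G A ≃+ trivialCohomology G A 2) := by
  let R := Rep.trivial (ULift.{max u v} ℤ) (ULift.{v} G) (ULift.{u} A)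
  let toFun : twoCocycles G A →+ groupCohomology.cocycles₂ R :=
    { toFun f := ⟨fun p => ULift.up (f.1 p.1.down p.2.down), by
        rw [groupCohomology.mem_cocycles₂_iff]
        intro g h j
        exact congrArg ULift.up (f.2 g.down h.down j.down)⟩
      map_zero' := rfl
      map_add' _ _ := rfl }
  refine nonempty_addEquiv_of_ker_eq (QuotientAddGroup.mk' _)
    ((groupCohomology.H2π R).hom.toAddMonoidHom.comp toFun)
    (QuotientAddGroup.mk'_surjective _) ?_ fun f => ?_
  · intro y
    induction y using groupCohomology.H2_induction_on with
    | h x =>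
      refine ⟨⟨fun g h => ULift.down (x.1 (ULift.up g, ULift.up h)), fun g h j => ?_⟩, rfl⟩
      exact congrArg ULift.down
        ((groupCohomology.mem_cocycles₂_iff x.1).1 x.2 (ULift.up g) (ULift.up h) (ULift.up j))
  · refine (TrivialH2.mk_eq_zero_iff f).trans (Iff.trans ?_
      (groupCohomology.H2π_eq_zero_iff (toFun f)).symm)
    constructor
    · rintro ⟨x, hx⟩
      exact ⟨fun g => ULift.up (x g.down), funext fun p => congrArg ULift.up (hx _ _).symm⟩
    · rintro ⟨x, hx⟩
      exact ⟨fun g => ULift.down (x (ULift.up g)), fun g h =>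
        (congrArg ULift.down (congrFun hx (ULift.up g, ULift.up h))).symm⟩

/-- In positive even degree the periodic resolution gives ker(g − 1) modulo the image of the norm.
For the trivial action the kernel is all of A and the norm is multiplication by |G|. -/
theorem trivialCohomology_two_addEquiv_of_isCyclic (G : Type u) [Group G] [IsCyclic G] [Finite G]
    (A : Type v) [AddCommGroup A] :
    Nonempty (trivialCohomology G A 2 ≃+ A ⧸ multiples A (Nat.card G)) := by
  let _ : CommGroup (ULift.{v} G) := { (inferInstance : Group (ULift.{v} G)) with
    mul_comm := fun a b => ULift.ext _ _ (IsCyclic.commGroup.mul_comm a.down b.down) }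
  let _ : Fintype (ULift.{v} G) := Fintype.ofFinite _
  obtain ⟨g, hg⟩ := IsCyclic.exists_generator (α := G)
  have hg' : ∀ x : ULift.{v} G, x ∈ Subgroup.zpowers (ULift.up g) := fun x => by
    obtain ⟨m, hm⟩ := hg x.down
    exact ⟨m, ULift.ext _ _ hm⟩
  let R := Rep.trivial (ULift.{max u v} ℤ) (ULift.{v} G) (ULift.{u} A)
  let ι : A →+ LinearMap.ker (Rep.applyAsHom R (ULift.up g) - CategoryTheory.CategoryStruct.id R).hom.toLinearMap :=
    { toFun a := ⟨ULift.up a, by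
        rw [LinearMap.mem_ker, Rep.sub_hom]
        exact sub_self (ULift.up a)⟩
      map_zero' := rfl
      map_add' _ _ := rfl }
  let q := Rep.FiniteCyclicGroup.groupCohomologyπEven R (ULift.up g) hg' 2 even_two
  have hq : Function.Surjective q := by
    have : CategoryTheory.Epi q :=
      CategoryTheory.epi_comp' (@CategoryTheory.IsIso.epi_of_iso _ _ _ _ _
        (CategoryTheory.Iso.isIso_inv _)) (CategoryTheory.epi_comp' inferInstance inferInstance)
    exact (ModuleCat.epi_iff_surjective q).1 this
  refine nonempty_addEquiv_of_ker_eq (q.hom.toAddMonoidHom.comp ι) (QuotientAddGroup.mk' _)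
    (hq.comp fun x => ⟨x.1.down, rfl⟩) (QuotientAddGroup.mk'_surjective _) fun a => ?_
  refine (Rep.FiniteCyclicGroup.groupCohomologyπEven_eq_zero_iff R (ULift.up g) hg' 2 even_two
    (ι a)).trans (Iff.trans ?_ (QuotientAddGroup.eq_zero_iff a).symm)
  have hnorm : ∀ x : ULift.{u} A, R.norm.hom.toLinearMap x = Nat.card G • x := fun x => by
    have : Fintype.card (ULift.{v} G) = Nat.card G := by
      rw [← Nat.card_eq_fintype_card, Nat.card_ulift]
    change Representation.norm (Representation.trivial _ _ _) x = _
    simp [Representation.norm, this]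
  constructor
  · rintro ⟨x, hx⟩
    exact ⟨x.down, congrArg ULift.down ((hnorm x).symm.trans hx)⟩
  · rintro ⟨x, hx⟩
    exact ⟨ULift.up x, (hnorm (ULift.up x)).trans (congrArg ULift.up hx)⟩

/-! ### Biadditive maps on cyclic groups. -/

section Biadditive

variable {A : Type*} [AddCommGroup A]

/-- A cyclic group maps to any abelian group by sending a generator to an element killed by the
order. -/
theorem exists_map_of_generator {G : Type*} [Group G] {g : G}
    (hg : ∀ x, x ∈ Subgroup.zpowers g) (a : A) (ha : Nat.card G • a = 0) :
    ∃ φ : G → A, (∀ x y, φ (x * y) = φ x + φ y) ∧ φ g = a ∧ ∀ x, ∃ m : ℤ, φ x = m • a := by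
  have h : orderOf (Multiplicative.ofAdd a) ∣ orderOf g := by
    rw [orderOf_eq_card_of_forall_mem_zpowers hg]
    exact orderOf_dvd_of_pow_eq_one (congrArg Multiplicative.ofAdd ha)
  let φ := monoidHomOfForallMemZpowers hg h
  have h1 : φ g = Multiplicative.ofAdd a := monoidHomOfForallMemZpowers_apply_gen hg h
  refine ⟨fun x => (φ x).toAdd, fun x y => by simp, by simp [h1], fun x => ?_⟩
  obtain ⟨m, rfl⟩ := hg x
  exact ⟨m, by simp [h1]⟩

/-- A biadditive map on two cyclic groups with a given value on the generators. -/
theorem exists_biadditive_of_generators {G H : Type*} [Group G] [Group H] {g : G} {h : H}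
    (hg : ∀ x, x ∈ Subgroup.zpowers g) (hh : ∀ x, x ∈ Subgroup.zpowers h) (a : A)
    (ha : Nat.card G • a = 0) (ha' : Nat.card H • a = 0) :
    ∃ b : biadditive G A H, b.1 g h = a := by
  obtain ⟨φ, hφ, hφh, hm⟩ := exists_map_of_generator hh a ha'
  have : Nat.card G • φ = 0 := funext fun x => by
    obtain ⟨m, hm⟩ := hm x
    simp [hm, smul_comm _ m, ha]
  -- Now the coefficients are the functions H → A. Each value of ψ is an integer multiple of φ,
  -- hence additive in the second variable.
  obtain ⟨ψ, hψ, hψg, hm'⟩ := exists_map_of_generator hg φ this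
  refine ⟨⟨ψ, fun x y z => by simp [hψ], fun x y z => ?_⟩, by simp [hψg, hφh]⟩
  obtain ⟨m, hm⟩ := hm' x
  simp [hm, hφ]

/-- The additive map in the second variable. -/
def biadditive.right {G H : Type*} [Group G] [Group H] (b : biadditive G A H) (g : G) :
    H →* Multiplicative A :=
  MonoidHom.mk' (fun h => Multiplicative.ofAdd (b.1 g h)) fun x y =>
    congrArg Multiplicative.ofAdd (b.2.2 g x y)

/-- The additive map in the first variable. -/
def biadditive.left {G H : Type*} [Group G] [Group H] (b : biadditive G A H) (h : H) :
    G →* Multiplicative A :=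
  MonoidHom.mk' (fun g => Multiplicative.ofAdd (b.1 g h)) fun x y =>
    congrArg Multiplicative.ofAdd (b.2.1 x y h)

theorem biadditive.card_smul_left {G H : Type*} [Group G] [Group H] (b : biadditive G A H)
    (g : G) (h : H) : Nat.card G • b.1 g h = 0 := by
  have := map_pow (left b h) g (Nat.card G)
  -- `Nat.card G` is 0 for infinite G, so finiteness is not needed.
  rw [pow_card_eq_one', map_one] at this
  exact congrArg Multiplicative.toAdd this.symm

theorem biadditive.card_smul_right {G H : Type*} [Group G] [Group H] (b : biadditive G A H)
    (g : G) (h : H) : Nat.card H • b.1 g h = 0 := by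
  have := map_pow (right b g) h (Nat.card H)
  rw [pow_card_eq_one', map_one] at this
  exact congrArg Multiplicative.toAdd this.symm

theorem biadditive.eq_zero_of_generators {G H : Type*} [Group G] [Group H] {g : G} {h : H}
    (hg : ∀ x, x ∈ Subgroup.zpowers g) (hh : ∀ x, x ∈ Subgroup.zpowers h)
    (b : biadditive G A H) (hb : b.1 g h = 0) (x : G) (y : H) : b.1 x y = 0 := by
  obtain ⟨m, rfl⟩ := hg x
  obtain ⟨l, rfl⟩ := hh y
  have h1 := map_zpow (left b (h ^ l)) g m
  have h2 := map_zpow (right b g) h l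
  have h2' : b.1 g (h ^ l) = l • b.1 g h := congrArg Multiplicative.toAdd h2
  have h1' : b.1 (g ^ m) (h ^ l) = m • b.1 g (h ^ l) := congrArg Multiplicative.toAdd h1
  simpa [h2', hb] using h1'

/-- Biadditive maps on a cyclic group and a product of cyclic groups. -/
theorem biadditive.nonempty_addEquiv_pi {ι : Type*} [Fintype ι] [DecidableEq ι] {G : Type*}
    [Group G] [IsCyclic G] (H : ι → Type*) [∀ i, CommGroup (H i)] [∀ i, IsCyclic (H i)] :
    Nonempty (biadditive G A (∀ i, H i) ≃+ ∀ i,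
      (annihilatedBy A (Nat.card G) ⊓ annihilatedBy A (Nat.card (H i)) : AddSubgroup A)) := by
  obtain ⟨g, hg⟩ := IsCyclic.exists_generator (α := G)
  choose h hh using fun i => IsCyclic.exists_generator (α := H i)
  let res (i : ι) : biadditive G A (∀ i, H i) →+ biadditive G A (H i) :=
    { toFun b := ⟨fun x y => b.1 x (Pi.mulSingle i y), fun x y z => b.2.1 _ _ _, fun x y z => by
        simp only [Pi.mulSingle_mul, b.2.2]⟩
      map_zero' := rfl
      map_add' _ _ := rfl }
  let F : biadditive G A (∀ i, H i) →+ ∀ i,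
      (annihilatedBy A (Nat.card G) ⊓ annihilatedBy A (Nat.card (H i)) : AddSubgroup A) :=
    { toFun b i := ⟨(res i b).1 g (h i),
        card_smul_left (res i b) g (h i), card_smul_right (res i b) g (h i)⟩
      map_zero' := rfl
      map_add' _ _ := rfl }
  refine ⟨AddEquiv.ofBijective F ⟨(injective_iff_map_eq_zero F).2 fun b hb => ?_, fun a => ?_⟩⟩
  · refine Subtype.ext (funext fun x => funext fun y => ?_)
    have h1 : right b x = 1 := MonoidHom.functions_ext _ _ _ fun i z =>
      congrArg Multiplicative.ofAdd (eq_zero_of_generators hg (hh i) (res i b)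
        (congrArg Subtype.val (congrFun hb i)) x z)
    exact congrArg Multiplicative.toAdd (DFunLike.congr_fun h1 y)
  · choose c hc using fun i => exists_biadditive_of_generators hg (hh i) (a i).1 (a i).2.1 (a i).2.2
    refine ⟨⟨fun x y => ∑ i, (c i).1 x (y i), fun x y z => ?_, fun x y z => ?_⟩, ?_⟩
    · simp [(c _).2.1, Finset.sum_add_distrib]
    · simp [(c _).2.2, Finset.sum_add_distrib]
    · refine funext fun i => Subtype.ext ?_
      refine (Finset.sum_eq_single i (fun j _ hj => ?_) (by simp)).trans ?_
      · rw [Pi.mulSingle_eq_of_ne hj]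
        exact congrArg Multiplicative.toAdd (map_one (right (c j) g))
      · rw [Pi.mulSingle_eq_same, hc]

end Biadditive

/-! ### Induction on the number of factors. -/

/-- Functions on `Fin (k + 1)`, split at `0`. -/
def finSuccPiMulEquiv {k : ℕ} (G : Fin (k + 1) → Type*) [∀ i, Mul (G i)] :
    (∀ i, G i) ≃* G 0 × ∀ i : Fin k, G i.succ :=
  { (Fin.consEquiv G).symm with map_mul' _ _ := rfl }

/-- Functions on `Fin (k + 1)`, split at `0`. -/
def finSuccPiAddEquiv {k : ℕ} (X : Fin (k + 1) → Type*) [∀ i, Add (X i)] :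
    (∀ i, X i) ≃+ X 0 × ∀ i : Fin k, X i.succ :=
  { (Fin.consEquiv X).symm with map_add' _ _ := rfl }

/-- Functions on pairs in `Fin (k + 1)`, split by whether the first entry is `0`. -/
def finSuccPairsAddEquiv {k : ℕ} (Y : Fin (k + 1) → Fin (k + 1) → Type*) [∀ i j, Add (Y i j)] :
    (∀ p : {p : Fin (k + 1) × Fin (k + 1) // p.1 < p.2}, Y p.1.1 p.1.2) ≃+
      (∀ j : Fin k, Y 0 j.succ) ×
        ∀ p : {p : Fin k × Fin k // p.1 < p.2}, Y p.1.1.succ p.1.2.succ where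
  toFun f := (fun j => f ⟨(0, j.succ), j.succ_pos⟩,
    fun p => f ⟨(p.1.1.succ, p.1.2.succ), Fin.succ_lt_succ_iff.2 p.2⟩)
  invFun f
    | ⟨(i, j), h⟩ =>
      Fin.cases (motive := fun i => i < j → Y i j)
        (fun h => Fin.cases (motive := fun j => 0 < j → Y 0 j)
          (fun h => absurd h (lt_irrefl _)) (fun j _ => f.1 j) j h)
        (fun i h => Fin.cases (motive := fun j => i.succ < j → Y i.succ j)
          (fun h => absurd h (Fin.not_lt_zero _))
          (fun j h => f.2 ⟨(i, j), Fin.succ_lt_succ_iff.1 h⟩) j h) i h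
  left_inv f := by
    funext ⟨⟨i, j⟩, h⟩
    cases i using Fin.cases <;> cases j using Fin.cases
    · exact absurd h (lt_irrefl _)
    · rfl
    · exact absurd h (Fin.not_lt_zero _)
    · rfl
  right_inv f := rfl
  map_add' _ _ := rfl

theorem TrivialH2.nonempty_pi_addEquiv (A : Type v) [AddCommGroup A] (k : ℕ)
    (G : Fin k → Type u) [∀ i, CommGroup (G i)] [∀ i, IsCyclic (G i)] [∀ i, Finite (G i)] :
    Nonempty (TrivialH2 (∀ i, G i) A ≃+
      (∀ i, A ⧸ multiples A (Nat.card (G i))) ×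
      (∀ p : {p : Fin k × Fin k // p.1 < p.2},
        (annihilatedBy A (Nat.card (G p.1.1)) ⊓ annihilatedBy A (Nat.card (G p.1.2)) :
          AddSubgroup A))) := by
  induction k with
  | zero =>
    have := TrivialH2.subsingleton (∀ i, G i) A
    have : IsEmpty {p : Fin 0 × Fin 0 // p.1 < p.2} := ⟨fun p => p.1.1.elim0⟩
    exact ⟨{ toFun := 0, invFun := 0, left_inv _ := Subsingleton.elim _ _,
             right_inv _ := Subsingleton.elim _ _, map_add' _ _ := Subsingleton.elim _ _ }⟩
  | succ k ih =>
    obtain ⟨e₁⟩ := TrivialH2.nonempty_congr (finSuccPiMulEquiv G) A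
    obtain ⟨e₂⟩ := TrivialH2.nonempty_prod_addEquiv (G 0) (∀ i : Fin k, G i.succ) A
    obtain ⟨e₃⟩ := trivialCohomology_two_addEquiv (G 0) A
    obtain ⟨e₄⟩ := trivialCohomology_two_addEquiv_of_isCyclic (G 0) A
    obtain ⟨e₅⟩ := ih fun i => G i.succ
    obtain ⟨e₆⟩ := biadditive.nonempty_addEquiv_pi (A := A) (G := G 0) fun i : Fin k => G i.succ
    let s := finSuccPiAddEquiv fun i => A ⧸ multiples A (Nat.card (G i))
    let t := finSuccPairsAddEquiv fun i j =>
      (annihilatedBy A (Nat.card (G i)) ⊓ annihilatedBy A (Nat.card (G j)) : AddSubgroup A)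
    -- The pairings of factor 0 with the rest supply the pairs (0, j); the induction hypothesis
    -- supplies the pairs of successors.
    exact ⟨(e₁.trans e₂).trans
      (((e₃.trans e₄).prodCongr ((e₅.prodCongr e₆).trans
        (AddEquiv.prodAssoc.trans ((AddEquiv.refl _).prodCongr AddEquiv.prodComm)))).trans
      (AddEquiv.prodAssoc.symm.trans (s.symm.prodCongr t.symm)))⟩

theorem mainTheorem2 (k : ℕ) (G : Fin k → Type u) [∀ i, Group (G i)] [∀ i, IsCyclic (G i)]
    (n : Fin k → ℕ) (hn : ∀ i, 0 < n i) (hG : ∀ i, Nat.card (G i) = n i)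
    (A : Type v) [AddCommGroup A] :
    Nonempty
      (trivialCohomology (∀ i, G i) A 2 ≃+
        (⨁ i : Fin k, A ⧸ multiples A (n i)) ×
        (⨁ p : {p : Fin k × Fin k // p.1 < p.2},
          (annihilatedBy A (n p.1.1) ⊓ annihilatedBy A (n p.1.2) : AddSubgroup A))) := by
  obtain rfl : (fun i => Nat.card (G i)) = n := funext hG
  have : ∀ i, Finite (G i) := fun i => Nat.finite_of_card_ne_zero (hn i).ne'
  obtain ⟨e₁⟩ := trivialCohomology_two_addEquiv (∀ i, G i) A
  obtain ⟨e₂⟩ := @TrivialH2.nonempty_pi_addEquiv A _ k G (fun _ => IsCyclic.commGroup) _ _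
  exact ⟨(e₁.symm.trans e₂).trans
    ((DirectSum.addEquivProd _).symm.prodCongr (DirectSum.addEquivProd _).symm)⟩
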